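/- Let $p$ be a prime, let $\mathbb{F}_q$ be a finite field with $q=p^n$ elements, let $\mathbb{A}=\mathbb{F}_q[T]$, let $\mathbb{A}_+$ be the set of monic polynomials in $\mathbb{A}$, and put $|G|=q^{\deg G}$ for $G\in\mathbb{A}\setminus\{0\}$. Below, $D,E$ as divisors are monic, $(\cdot,\dots,\cdot)$ and $[\cdot,\dots,\cdot]$ denote the monic greatest common divisor and least common multiple, and: - $\zeta_{\mathbb{A}}(w)=\sum_{f\in\mathbb{A}_+}|f|^{-w}$ for real $w>1$; - $\mu(G)=0$ if $G$ is not squarefree, and $\mu(G)=(-1)^t$ if $G$ is a constant times a product of $t$ distinct monic irreducible polynomials; - $\phi_s(G)=\sum_{D\mid G}\mu(G/D)|D|^s$ for $s\in\mathbb{R}$, $G\in\mathbb{A}_+$, and $\phi(G)=\#\{D\in\mathbb{A}:\deg D<\deg G,\ (D,G)=1\}$ (with $\deg 0=-\infty$) is Euler's function; - $E\,\|\,H$ means that $E$ is monic, $E\mid H$ and $(E,H/E)=1$, and $(D,H)_*$ is the element of highest degree of $\{E: E\mid D,\ E\,\|\,H\}$; - for $H\in\mathbb{A}_+$ of degree $m$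 and $A\in\mathbb{A}$ with $A\equiv a_{m-1}T^{m-1}+\cdots+a_0 \pmod H$, put $t_H(A)=a_{m-1}$ (and $t_H(A)=0$ if $m=0$), and $E(G,H)(A)=\exp\big(2\pi i\,\mathrm{tr}(t_H(GA))/p\big)$, where $\mathrm{tr}:\mathbb{F}_q\to\mathbb{F}_p$ is the trace; - the unitary polynomial Ramanujan sum is $$\eta^*(G,H)=\sum_{\substack{D \bmod H\\ (D,H)_*=1}}E(G,H)(D).$$ Let $k\ge 1$ be an integer and $G_1,\dots,G_k\in\mathbb{A}_+$. Then for every real $s$ with $k+s>1$ the series $\zeta_{\mathbb{A}}(k+s)$ converges and $$\frac{\phi_s((G_1,\dots,G_k))}{|(G_1,\dots,G_k)|^s}=\frac{1}{\zeta_{\mathbb{A}}(k+s)}\sum_{H_1,\dots,H_k\in\mathbb{A}_+}\frac{\mu(Q)\,\eta^*(G_1,H_1)\cdots\eta^*(G_k,H_k)}{\phi_{k+s}(Q)},\qquad Q=[H_1,\dots,H_k],$$ the series on the right being absolutely convergent. Moreover, $$\frac{\phi((G_1,\dots,G_k))}{|(G_1,\dots,G_k)|}=\frac{1}{\zeta_{\mathbb{A}}(k+1)}\sum_{H_1,\dots,H_k\in\mathbb{A}_+}\frac{\mu(Q)\,\eta^*(G_1,H_1)\cdots\eta^*(G_k,H_k)}{\phi_{k+1}(Q)},$$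 again with absolute convergence. -/

import Mathlib

open Polynomial

namespace PolyRamanujan

noncomputable section

/-- The set `𝔸₊` of monic polynomials over `F`. -/
abbrev MonicPoly (F : Type*) [Field F] : Type _ := {G : F[X] // G.Monic}

/-- The absolute value `|G| = q ^ deg G` on `F[T]`, where `q = #F` (and `|0| = 0`). -/
def absVal {F : Type*} [Field F] [Fintype F] (G : F[X]) : ℝ := (cardPowDegree G : ℝ)

/-- The zeta function `ζ_𝔸(w) = ∑ 1 / |f| ^ w`, the sum running over all monic `f`. -/
def zetaA (F : Type*) [Field F] [Fintype F] (w : ℝ) : ℝ :=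
  ∑' f : MonicPoly F, 1 / absVal f.1 ^ w

theorem finite_degree_lt (F : Type*) [Field F] [Fintype F] (n : ℕ) :
    {D : F[X] | D.degree < n}.Finite := by
  have h : Finite (degreeLT F n) := Finite.of_equiv _ (degreeLTEquiv F n).symm.toEquiv
  refine Set.Finite.subset (Set.toFinite (degreeLT F n : Set F[X])) ?_
  intro D hD
  exact mem_degreeLT.2 hD

/-- The polynomials of degree `< n` (including `0`). For `n = deg H` they form a complete system
of residues modulo a nonzero `H`. -/
def polysDegreeLT (F : Type*) [Field F] [Fintype F] (n : ℕ) : Finset F[X] :=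
  (finite_degree_lt F n).toFinset

open Classical in
/-- The monic divisors of a nonzero polynomial `G`. -/
def monicDivisors {F : Type*} [Field F] [Fintype F] (G : F[X]) : Finset F[X] :=
  {D ∈ polysDegreeLT F (G.natDegree + 1) | D.Monic ∧ D ∣ G}

theorem mem_monicDivisors {F : Type*} [Field F] [Fintype F] {G D : F[X]} (hG : G ≠ 0) :
    D ∈ monicDivisors G ↔ D.Monic ∧ D ∣ G := by
  simp only [monicDivisors, polysDegreeLT, Finset.mem_filter, Set.Finite.mem_toFinset,
    Set.mem_ofPred_eq, and_iff_right_iff_imp]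
  rintro ⟨-, h⟩
  refine lt_of_le_of_lt (degree_le_of_dvd h hG) ?_
  rw [degree_eq_natDegree hG]
  exact_mod_cast Nat.lt_succ_self _

/-- The Möbius function on `F[T]`: `0` if `G` is not squarefree, and `(-1) ^ t` if `G` is a
constant times a product of `t` distinct monic irreducible polynomials. -/
def mobius {F : Type*} [Field F] (G : F[X]) : ℤ := UniqueFactorizationMonoid.moebius G

/-- The Jordan totient function `φ_s(G) = ∑_{D ∣ G} μ(G / D) |D| ^ s`, the sum running over the
monic divisors of `G`. -/
def jordan {F : Type*} [Field F] [Fintype F] (s : ℝ) (G : F[X]) : ℝ :=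
  ∑ D ∈ monicDivisors G, (mobius (G / D) : ℝ) * absVal D ^ s

open Classical in
/-- Euler's function `φ(G) = #{D : deg D < deg G, (D, G) = 1}`. -/
def eulerPhi {F : Type*} [Field F] [Fintype F] (G : F[X]) : ℕ :=
  {D ∈ polysDegreeLT F G.natDegree | IsCoprime D G}.card

open Classical in
/-- The (monic) greatest common divisor of a family of polynomials. -/
def monicGcd {F : Type*} [Field F] {k : ℕ} (G : Fin k → F[X]) : F[X] := Finset.univ.gcd G

open Classical in
/-- The (monic) least common multiple of a family of polynomials. -/
def monicLcm {F : Type*} [Field F] {k : ℕ} (H : Fin k → F[X]) : F[X] := Finset.univ.lcm H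

/-- `E` is a unitary divisor of `H`: `E` is monic, `E ∣ H` and `(E, H / E) = 1`. -/
def IsUnitaryDivisor {F : Type*} [Field F] (E H : F[X]) : Prop :=
  E.Monic ∧ E ∣ H ∧ IsCoprime E (H / E)

/-- `E = (D, H)_*`: `E` is the element of highest degree among the polynomials that divide `D`
and are unitary divisors of `H`. -/
def IsUnitaryGcd {F : Type*} [Field F] (E D H : F[X]) : Prop :=
  (E ∣ D ∧ IsUnitaryDivisor E H) ∧
    ∀ E' : F[X], E' ∣ D → IsUnitaryDivisor E' H → E'.degree ≤ E.degree

/-- If `A ≡ a_{m-1} T^{m-1} + ⋯ + a_0 (mod H)` with `m = deg H`, then `tCoeff H A = a_{m-1}`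
(for `m = 0` the remainder is `0` and so is the value). -/
def tCoeff {F : Type*} [Field F] (H A : F[X]) : F := (A % H).coeff (H.natDegree - 1)

/-- The additive character `E(G, H)(A) = exp (2πi tr(t(G A)) / p)` modulo `H`, where `tr` is the
trace from `F` to its prime field `ZMod p`; here `ZMod.stdAddChar` is `j ↦ exp (2πi j / p)`. -/
def addCharE (p : ℕ) [Fact p.Prime] {F : Type*} [Field F] [Algebra (ZMod p) F]
    (G H A : F[X]) : ℂ :=
  ZMod.stdAddChar (Algebra.trace (ZMod p) F (tCoeff H (G * A)))

open Classical in
/-- The unitary polynomial Ramanujan sum `η*(G, H)`: the sum of `E(G, H)(D)` over the residues `D`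
modulo `H` with `(D, H)_* = 1`. -/
def etaStar (p : ℕ) [Fact p.Prime] {F : Type*} [Field F] [Fintype F] [Algebra (ZMod p) F]
    (G H : F[X]) : ℂ :=
  ∑ D ∈ polysDegreeLT F H.natDegree with IsUnitaryGcd 1 D H, addCharE p G H D

/-- The term `μ(Q) η*(G₁, H₁) ⋯ η*(G_k, H_k) / φ_w(Q)` with `Q = [H₁, …, H_k]`. -/
def expansionTerm (p : ℕ) [Fact p.Prime] {F : Type*} [Field F] [Fintype F] [Algebra (ZMod p) F]
    {k : ℕ} (w : ℝ) (G H : Fin k → MonicPoly F) : ℂ :=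
  ((mobius (monicLcm fun i => (H i).1) : ℤ) : ℂ) * (∏ i, etaStar p (G i).1 (H i).1) /
    ((jordan w (monicLcm fun i => (H i).1) : ℝ) : ℂ)

end

end PolyRamanujan

/-! Write `w = k + s`, `g = (G₁, …, G_k)` and `σ(G) = ∑_{D ∣ G} |D|`. Two facts carry the proof.

Arithmetic: every divisor of a squarefree `H` is unitary, so `η*(G, H)` is then the ordinary
Ramanujan sum `∑_{D ∣ (G, H)} μ(H / D) |D|`. Möbius inversion gives `∑_{H ∣ N} η*(G, H) = |N|` if `N
∣ G` and `0` otherwise, for squarefree `N` (`sum_etaStar`). The factor `μ(Q)` hides all other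
moduli.

Analytic: `μ(Q) / φ_w(Q) = ζ(w) ∑_{Q ∣ N} μ(N) / |N| ^ w` (`mobius_div_jordan`), from coprime
factorization of the series for `1 / ζ(w)`.

Since `Q ∣ N` means that all `H_i ∣ N`, substituting and summing over the `H_i` first leaves `ζ(w)
∑_{N ∣ g} μ(N) |N| ^ (k - w)`, which is `ζ(w) φ_s(g) / |g| ^ s`. The interchange is legitimate
because `|η*(G, H)| ≤ σ(G)` for squarefree `H`, while `N` admits `d(N) ^ k` tuples of divisors and
`∑ d(N) ^ k / |N| ^ w` converges (`summable_doubleTerm`). -/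

namespace PolyRamanujan

/-! ### Möbius function, divisor sums and residue systems -/

section Divisors

variable {F : Type*} [Field F]

theorem mobius_eq_zero {G : F[X]} (h : ¬ Squarefree G) : mobius G = 0 :=
  UniqueFactorizationMonoid.moebius_of_not_squarefree h

theorem mobius_one : mobius (1 : F[X]) = 1 := UniqueFactorizationMonoid.moebius_one

theorem mobius_mul {A B : F[X]} (h : IsCoprime A B) :
    mobius (A * B) = mobius A * mobius B :=
  h.isRelPrime.moebius_mul

theorem abs_mobius_le_one (G : F[X]) : |(mobius G : ℝ)| ≤ 1 := by
  by_cases h : Squarefree G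
  · rw [mobius, h.moebius_eq]
    simp
  · simp [mobius_eq_zero h]

theorem mul_div_self {D G : F[X]} (hG : G ≠ 0) (h : D ∣ G) : D * (G / D) = G :=
  EuclideanDomain.mul_div_cancel' (ne_zero_of_dvd_ne_zero hG h) h

theorem mul_div_self_left {D : F[X]} (hD : D ≠ 0) (K : F[X]) : D * K / D = K :=
  mul_div_cancel_left₀ K hD

theorem monic_div {D G : F[X]} (hG : G.Monic) (hD : D.Monic) (h : D ∣ G) : (G / D).Monic := by
  have := mul_div_self hG.ne_zero h
  rw [← this] at hG
  exact hD.of_mul_monic_left hG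

theorem monic_eq_one_of_isUnit {G : F[X]} (hG : G.Monic) (h : IsUnit G) : G = 1 :=
  hG.isUnit_iff.1 h

theorem isCoprime_of_squarefree_mul {A B : F[X]} (h : Squarefree (A * B)) : IsCoprime A B :=
  (squarefree_mul_iff.1 h).1.isCoprime

variable [Fintype F]

theorem absVal_eq_pow {G : F[X]} (hG : G ≠ 0) :
    absVal G = (Fintype.card F : ℝ) ^ G.natDegree := by
  rw [absVal, cardPowDegree_nonzero _ hG]
  push_cast
  rfl

theorem absVal_mul (A B : F[X]) : absVal (A * B) = absVal A * absVal B := by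
  simp [absVal]

theorem absVal_one : absVal (1 : F[X]) = 1 := by
  simp [absVal]

theorem absVal_pos {G : F[X]} (hG : G ≠ 0) : 0 < absVal G := by
  rw [absVal_eq_pow hG]
  have : 0 < Fintype.card F := Fintype.card_pos
  positivity

theorem absVal_nonneg (G : F[X]) : 0 ≤ absVal G := by
  rw [absVal]
  exact_mod_cast (cardPowDegree : AbsoluteValue F[X] ℤ).nonneg G

/-- Complementary divisors: the involution `D ↦ G / D` of the monic divisors of `G`. -/
theorem sum_monicDivisors_div {M : Type*} [AddCommMonoid M] {G : F[X]} (hG : G.Monic)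
    (f : F[X] → F[X] → M) :
    ∑ D ∈ monicDivisors G, f D (G / D) = ∑ D ∈ monicDivisors G, f (G / D) D := by
  have key : ∀ D ∈ monicDivisors G, G / D ∈ monicDivisors G ∧ G / (G / D) = D := by
    intro D hD
    obtain ⟨hDm, hDG⟩ := (mem_monicDivisors hG.ne_zero).1 hD
    have h1 := mul_div_self hG.ne_zero hDG
    have hm := monic_div hG hDm hDG
    refine ⟨(mem_monicDivisors hG.ne_zero).2 ⟨hm, Dvd.intro_left _ h1⟩, ?_⟩
    nth_rw 1 [← h1]
    rw [mul_comm]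
    exact mul_div_self_left hm.ne_zero D
  refine Finset.sum_nbij' (fun D => G / D) (fun D => G / D) (fun D hD => (key D hD).1)
    (fun D hD => (key D hD).1) (fun D hD => (key D hD).2) (fun D hD => (key D hD).2) ?_
  intro D hD
  simp only [(key D hD).2]

open Classical in
-- For `N ≠ 1`, fix a monic irreducible `P ∣ N`: inserting or removing the factor `P` is a
-- sign-reversing involution on the squarefree divisors.
theorem sum_mobius {N : F[X]} (hN : N.Monic) :
    ∑ D ∈ monicDivisors N, mobius D = if N = 1 then 1 else 0 := by
  split_ifs with h
  · subst h
    have : monicDivisors (1 : F[X]) = {1} := by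
      ext D
      rw [mem_monicDivisors one_ne_zero, Finset.mem_singleton]
      constructor
      · rintro ⟨h1, h2⟩
        exact monic_eq_one_of_isUnit h1 (isUnit_of_dvd_one h2)
      · rintro rfl
        exact ⟨monic_one, dvd_rfl⟩
    rw [this, Finset.sum_singleton, mobius_one]
  · have hu : ¬ IsUnit N := fun hu => h (monic_eq_one_of_isUnit hN hu)
    obtain ⟨P, hPm, hPi, hPN⟩ := exists_monic_irreducible_factor N hu
    have hP0 := hPm.ne_zero
    -- The restriction to squarefree `D` ensures that `P` does not divide `D / P`, so that the
    -- toggling map is an involution.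
    rw [← Finset.sum_filter_of_ne (p := fun D => Squarefree D)]
    swap
    · intro D _ hD
      by_contra hs
      exact hD (mobius_eq_zero hs)
    have cop : ∀ D, ¬ P ∣ D → IsCoprime P D := fun D hD =>
      (hPi.coprime_iff_not_dvd).2 hD
    have muP : mobius P = -1 := hPi.moebius_eq
    have hdiv : ∀ D, Squarefree D → P ∣ D → ¬ P ∣ D / P := by
      intro D hs hd hd'
      have h1 := mul_div_self hs.ne_zero hd
      rw [← h1] at hs
      exact hPi.not_isUnit ((isCoprime_of_squarefree_mul hs).isUnit_of_dvd' dvd_rfl hd')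
    refine Finset.sum_involution (fun D _ => if P ∣ D then D / P else P * D) ?_ ?_ ?_ ?_
    · intro D hD
      rw [Finset.mem_filter, mem_monicDivisors hN.ne_zero] at hD
      obtain ⟨⟨hDm, hDN⟩, hs⟩ := hD
      split_ifs with hPD
      · have h1 := mul_div_self hDm.ne_zero hPD
        have h2 := mobius_mul (cop _ (hdiv D hs hPD))
        rw [h1, muP] at h2
        rw [h2]
        ring
      · rw [mobius_mul (cop _ hPD), muP]
        ring
    · intro D hD _
      rw [Finset.mem_filter, mem_monicDivisors hN.ne_zero] at hD
      obtain ⟨⟨hDm, hDN⟩, hs⟩ := hD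
      split_ifs with hPD
      · intro he
        exact hdiv D hs hPD (by rw [he]; exact hPD)
      · intro he
        exact hPD (he ▸ dvd_mul_right P D)
    · intro D hD
      rw [Finset.mem_filter, mem_monicDivisors hN.ne_zero] at hD ⊢
      obtain ⟨⟨hDm, hDN⟩, hs⟩ := hD
      split_ifs with hPD
      · have h1 := mul_div_self hDm.ne_zero hPD
        have h2 : D / P ∣ D := Dvd.intro_left _ h1
        exact ⟨⟨monic_div hDm hPm hPD, h2.trans hDN⟩, hs.squarefree_of_dvd h2⟩
      · exact ⟨⟨hPm.mul hDm, (cop _ hPD).mul_dvd hPN hDN⟩,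
          squarefree_mul_iff.2 ⟨(cop _ hPD).isRelPrime, hPi.squarefree, hs⟩⟩
    · intro D hD
      rw [Finset.mem_filter, mem_monicDivisors hN.ne_zero] at hD
      obtain ⟨⟨hDm, hDN⟩, hs⟩ := hD
      by_cases hPD : P ∣ D
      · simp only [hPD, if_true, if_neg (hdiv D hs hPD)]
        exact mul_div_self hDm.ne_zero hPD
      · simp only [hPD, if_false, dvd_mul_right, if_true]
        exact mul_div_self_left hP0 D

open Classical in
-- The common divisors of `A` and `G` are the divisors of their gcd, so this detects whether that
-- gcd is `1`.
theorem sum_mobius_common {G : F[X]} (hG : G.Monic) (A : F[X]) :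
    ∑ D ∈ monicDivisors G with D ∣ A, mobius D = if IsCoprime A G then 1 else 0 := by
  have hg0 : EuclideanDomain.gcd A G ≠ 0 :=
    fun h => hG.ne_zero (EuclideanDomain.gcd_eq_zero_iff.1 h).2
  have hm : (normalize (EuclideanDomain.gcd A G)).Monic := monic_normalize hg0
  have hset : {D ∈ monicDivisors G | D ∣ A} =
      monicDivisors (normalize (EuclideanDomain.gcd A G)) := by
    ext D
    rw [Finset.mem_filter, mem_monicDivisors hG.ne_zero, mem_monicDivisors hm.ne_zero,
      dvd_normalize_iff]
    constructor
    · rintro ⟨⟨h1, h2⟩, h3⟩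
      exact ⟨h1, EuclideanDomain.dvd_gcd h3 h2⟩
    · rintro ⟨h1, h2⟩
      exact ⟨⟨h1, h2.trans (EuclideanDomain.gcd_dvd_right _ _)⟩,
        h2.trans (EuclideanDomain.gcd_dvd_left _ _)⟩
  rw [hset, sum_mobius hm]
  refine if_congr ?_ rfl rfl
  rw [normalize_eq_one, EuclideanDomain.gcd_isUnit_iff]

theorem mem_polysDegreeLT {n : ℕ} {D : F[X]} : D ∈ polysDegreeLT F n ↔ D.degree < n := by
  simp [polysDegreeLT]

theorem card_polysDegreeLT (n : ℕ) : (polysDegreeLT F n).card = Fintype.card F ^ n := by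
  have e : polysDegreeLT F n ≃ (Fin n → F) :=
    (Equiv.subtypeEquivRight fun D => by rw [mem_polysDegreeLT, mem_degreeLT]).trans
      (degreeLTEquiv F n).toEquiv
  have := Fintype.card_congr e
  simpa using this

open Classical in
theorem sum_polysDegreeLT_dvd {M : Type*} [AddCommMonoid M] {D K : F[X]} (hD : D.Monic)
    (hK : K.Monic) (f : F[X] → M) :
    ∑ A ∈ polysDegreeLT F (D * K).natDegree with D ∣ A, f A =
      ∑ B ∈ polysDegreeLT F K.natDegree, f (D * B) := by
  symm
  have hdeg : ∀ B : F[X], (D * B).degree < ((D * K).natDegree : WithBot ℕ) ↔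
      B.degree < (K.natDegree : WithBot ℕ) := by
    intro B
    rw [← degree_eq_natDegree (hD.mul hK).ne_zero, ← degree_eq_natDegree hK.ne_zero]
    by_cases hB : B = 0
    · simp [hB, bot_lt_iff_ne_bot, hD.ne_zero, hK.ne_zero]
    · rw [degree_eq_natDegree (mul_ne_zero hD.ne_zero hB),
        degree_eq_natDegree (hD.mul hK).ne_zero, degree_eq_natDegree hB,
        degree_eq_natDegree hK.ne_zero, natDegree_mul hD.ne_zero hB,
        natDegree_mul hD.ne_zero hK.ne_zero]
      norm_cast
      omega
  refine Finset.sum_nbij (fun B => D * B) ?_ ?_ ?_ (fun _ _ => rfl)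
  · intro B hB
    rw [Finset.mem_filter, mem_polysDegreeLT, hdeg]
    exact ⟨mem_polysDegreeLT.1 hB, dvd_mul_right _ _⟩
  · intro B _ B' _ h
    exact mul_left_cancel₀ hD.ne_zero h
  · intro A hA
    rw [Finset.mem_coe, Finset.mem_filter, mem_polysDegreeLT] at hA
    obtain ⟨hA, B, rfl⟩ := hA
    exact ⟨B, by rw [Finset.mem_coe, mem_polysDegreeLT, ← hdeg]; exact hA, rfl⟩

open Classical in
/-- Sums over the reduced residues modulo `G`, via Möbius inversion. -/
theorem sum_coprime_residues {R : Type*} [CommRing R] {G : F[X]} (hG : G.Monic) (f : F[X] → R) :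
    ∑ A ∈ polysDegreeLT F G.natDegree with IsCoprime A G, f A =
      ∑ D ∈ monicDivisors G, (mobius D : R) *
        ∑ B ∈ polysDegreeLT F (G / D).natDegree, f (D * B) := by
  have h1 : ∀ A : F[X], (if IsCoprime A G then f A else 0) =
      ∑ D ∈ monicDivisors G, if D ∣ A then (mobius D : R) * f A else 0 := by
    intro A
    have := congrArg (fun z : ℤ => (z : R) * f A) (sum_mobius_common hG A)
    simp only [Int.cast_sum, Finset.sum_mul] at this
    rw [← Finset.sum_filter, this]
    split_ifs <;> simp
  rw [Finset.sum_filter, Finset.sum_congr rfl fun A _ => h1 A, Finset.sum_comm]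
  refine Finset.sum_congr rfl fun D hD => ?_
  obtain ⟨hDm, hDG⟩ := (mem_monicDivisors hG.ne_zero).1 hD
  have := sum_polysDegreeLT_dvd hDm (monic_div hG hDm hDG) f
  rw [mul_div_self hG.ne_zero hDG] at this
  rw [← this, ← Finset.sum_filter, Finset.mul_sum]

theorem eulerPhi_eq_jordan_one {G : F[X]} (hG : G.Monic) : (eulerPhi G : ℝ) = jordan 1 G := by
  classical
  have h := sum_coprime_residues hG (fun _ => (1 : ℝ))
  rw [Finset.sum_const, nsmul_eq_mul, mul_one] at h
  rw [eulerPhi, h, jordan,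
    ← sum_monicDivisors_div hG fun D K => (mobius D : ℝ) * absVal K ^ (1 : ℝ)]
  refine Finset.sum_congr rfl fun D hD => ?_
  obtain ⟨hDm, hDG⟩ := (mem_monicDivisors hG.ne_zero).1 hD
  rw [Finset.sum_const, nsmul_eq_mul, mul_one, card_polysDegreeLT, Real.rpow_one,
    absVal_eq_pow (monic_div hG hDm hDG).ne_zero]
  push_cast
  rfl

end Divisors

/-! ### Additive characters and the unitary Ramanujan sum -/

section RamanujanSum

variable {F : Type*} [Field F]

/-- Remainders scale: `(D * A) % (D * K) = D * (A % K)`, and a monic `D` only shifts the top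
coefficient by `deg D`. -/
theorem tCoeff_mul_left {D K : F[X]} (hD : D.Monic) (hK : K.Monic) (A : F[X]) :
    tCoeff (D * K) (D * A) = tCoeff K A := by
  have hmod : (D * A) % (D * K) = D * (A % K) := by
    rw [← modByMonic_eq_mod _ (hD.mul hK)]
    refine (div_modByMonic_unique (A / K) (D * (A % K)) (hD.mul hK) ⟨?_, ?_⟩).2
    · conv_rhs => rw [← EuclideanDomain.mod_add_div A K]
      ring
    · rw [degree_mul, degree_mul]
      have h1 : (A % K).degree < K.degree := degree_mod_lt A hK.ne_zero
      rw [degree_eq_natDegree hD.ne_zero]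
      exact WithBot.add_lt_add_left (by simp) h1
  rw [tCoeff, tCoeff, hmod, natDegree_mul hD.ne_zero hK.ne_zero]
  -- For `deg K = 0` the truncated index `deg K - 1` is meaningless, but `K = 1` and the remainder
  -- vanishes.
  rcases Nat.eq_zero_or_pos K.natDegree with h0 | h0
  · rw [hK.natDegree_eq_zero.1 h0]
    simp
  · have h1 : (A % K).natDegree ≤ K.natDegree - 1 := by
      have := natDegree_mod_lt A h0.ne'
      omega
    rw [Nat.add_sub_assoc h0, coeff_mul_add_eq_of_natDegree_le le_rfl h1, hD.coeff_natDegree, one_mul]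

theorem tCoeff_add (H A B : F[X]) : tCoeff H (A + B) = tCoeff H A + tCoeff H B := by
  rw [tCoeff, add_mod, coeff_add, tCoeff, tCoeff]

theorem tCoeff_eq_zero_of_dvd {H A : F[X]} (h : H ∣ A) : tCoeff H A = 0 := by
  rw [tCoeff, EuclideanDomain.mod_eq_zero.2 h, coeff_zero]

/-- If `H ∤ G`, the functional `A ↦ tCoeff H (G * A)` is onto, even on residues modulo `H`. -/
theorem exists_tCoeff_eq {G H : F[X]} (hH : H.Monic) (h : ¬ H ∣ G) (c : F) :
    ∃ A : F[X], A.degree < (H.natDegree : WithBot ℕ) ∧ tCoeff H (G * A) = c := by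
  have hR0 : G % H ≠ 0 := fun h0 => h (EuclideanDomain.mod_eq_zero.1 h0)
  have hR : (G % H).degree < H.degree := degree_mod_lt G hH.ne_zero
  have hRn : (G % H).natDegree < H.natDegree := natDegree_lt_natDegree hR0 hR
  set R := G % H with hRdef
  -- Multiplication by `X ^ e` moves the leading coefficient of `R` to position `deg H - 1` without
  -- creating a reduction modulo `H`.
  set e := H.natDegree - 1 - R.natDegree with he
  have hlt : ∀ (b : F) (m : ℕ), m < H.natDegree → (C b * X ^ m : F[X]).degree < H.natDegree :=
    fun b m hm => (degree_C_mul_X_pow_le m b).trans_lt (by exact_mod_cast hm)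
  refine ⟨C (c / R.leadingCoeff) * X ^ e, hlt _ _ (by omega), ?_⟩
  have hdeg : (R * (C (c / R.leadingCoeff) * X ^ e)).degree < H.degree := by
    rw [degree_eq_natDegree hH.ne_zero]
    refine (degree_mul_le _ _).trans_lt ?_
    refine (add_le_add (degree_le_natDegree) (degree_C_mul_X_pow_le e _)).trans_lt ?_
    norm_cast
    omega
  have hmod : (G * (C (c / R.leadingCoeff) * X ^ e)) % H =
      R * (C (c / R.leadingCoeff) * X ^ e) := by
    rw [← modByMonic_eq_mod _ hH]
    refine (div_modByMonic_unique (G / H * (C (c / R.leadingCoeff) * X ^ e)) _ hH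
      ⟨?_, hdeg⟩).2
    conv_rhs => rw [← EuclideanDomain.mod_add_div G H]
    rw [← hRdef]
    ring
  have hsum : H.natDegree - 1 = R.natDegree + e := by omega
  rw [tCoeff, hmod, hsum, coeff_mul_add_eq_of_natDegree_le le_rfl
    (natDegree_C_mul_X_pow_le _ e), coeff_natDegree, coeff_C_mul_X_pow, if_pos rfl]
  field_simp [leadingCoeff_ne_zero.2 hR0]

variable (p : ℕ) [Fact p.Prime] [Algebra (ZMod p) F]

theorem addCharE_add (G H A B : F[X]) :
    addCharE p G H (A + B) = addCharE p G H A * addCharE p G H B := by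
  rw [addCharE, mul_add, tCoeff_add, map_add, AddChar.map_add_eq_mul, addCharE, addCharE]

theorem addCharE_mul_left {D K : F[X]} (hD : D.Monic) (hK : K.Monic) (G B : F[X]) :
    addCharE p G (D * K) (D * B) = addCharE p G K B := by
  rw [addCharE, addCharE, mul_left_comm, tCoeff_mul_left hD hK]

open Classical in
-- All monic divisors of a squarefree `H` are unitary, so the ordinary gcd competes in the maximum
-- defining the unitary one.
theorem isUnitaryGcd_one_iff {D H : F[X]} (hH : H.Monic) (hs : Squarefree H) :
    IsUnitaryGcd 1 D H ↔ IsCoprime D H := by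
  constructor
  · rintro ⟨-, h⟩
    by_contra hc
    have hg0 : EuclideanDomain.gcd D H ≠ 0 :=
      fun h => hH.ne_zero (EuclideanDomain.gcd_eq_zero_iff.1 h).2
    have hm : (normalize (EuclideanDomain.gcd D H)).Monic := monic_normalize hg0
    have hD : normalize (EuclideanDomain.gcd D H) ∣ D :=
      normalize_dvd_iff.2 (EuclideanDomain.gcd_dvd_left _ _)
    have hdH : normalize (EuclideanDomain.gcd D H) ∣ H :=
      normalize_dvd_iff.2 (EuclideanDomain.gcd_dvd_right _ _)
    have hle := h _ hD ⟨hm, hdH, isCoprime_of_squarefree_mul (by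
      rw [mul_div_self hH.ne_zero hdH]; exact hs)⟩
    rw [degree_one] at hle
    have h1 := hm.degree_le_zero_iff_eq_one.1 hle
    rw [normalize_eq_one, EuclideanDomain.gcd_isUnit_iff] at h1
    exact hc h1
  · intro hc
    refine ⟨⟨one_dvd _, monic_one, one_dvd _, isCoprime_one_left⟩, ?_⟩
    intro E hED hE
    rw [monic_eq_one_of_isUnit hE.1 (hc.isUnit_of_dvd' hED hE.2.1)]

variable [Fintype F]

open Classical in
-- Orthogonality: if `H ∤ G`, translating by some `A₀` multiplies the sum by a character value
-- different from `1`.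
theorem sum_addCharE {H : F[X]} (hH : H.Monic) (G : F[X]) :
    ∑ A ∈ polysDegreeLT F H.natDegree, addCharE p G H A =
      if H ∣ G then (absVal H : ℂ) else 0 := by
  split_ifs with h
  · have h1 : ∀ A ∈ polysDegreeLT F H.natDegree, addCharE p G H A = 1 := by
      intro A _
      rw [addCharE, tCoeff_eq_zero_of_dvd (h.mul_right A), map_zero, AddChar.map_zero_eq_one]
    rw [Finset.sum_congr rfl h1, Finset.sum_const, card_polysDegreeLT,
      absVal_eq_pow hH.ne_zero]
    simp
  · obtain ⟨c, hc⟩ : ∃ c : F, Algebra.trace (ZMod p) F c = 1 :=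
      Algebra.trace_surjective (ZMod p) F 1
    obtain ⟨A₀, hA₀, ht⟩ := exists_tCoeff_eq hH h c
    have hne : addCharE p G H A₀ ≠ 1 := by
      rw [addCharE, ht, hc]
      intro h1
      have := ZMod.injective_stdAddChar (h1.trans (AddChar.map_zero_eq_one _).symm)
      exact one_ne_zero this
    have hshift : ∑ A ∈ polysDegreeLT F H.natDegree, addCharE p G H A =
        ∑ A ∈ polysDegreeLT F H.natDegree, addCharE p G H (A + A₀) := by
      symm
      refine Finset.sum_nbij' (fun A => A + A₀) (fun A => A - A₀) ?_ ?_ ?_ ?_ ?_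
      · intro A hA
        rw [mem_polysDegreeLT] at hA ⊢
        exact (degree_add_le _ _).trans_lt (max_lt hA hA₀)
      · intro A hA
        rw [mem_polysDegreeLT] at hA ⊢
        exact (degree_sub_le _ _).trans_lt (max_lt hA hA₀)
      · intro A _
        simp
      · intro A _
        simp
      · intro A _
        rfl
    simp only [addCharE_add, ← Finset.sum_mul] at hshift
    by_contra hS
    exact hne (mul_left_cancel₀ hS (by rw [← hshift, mul_one]))

open Classical in
-- Möbius inversion removes the coprimality condition; the residues divisible by `D` then give a
-- complete character sum modulo `H / D`.
theorem etaStar_eq_sum {H : F[X]} (hH : H.Monic) (hs : Squarefree H) (G : F[X]) :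
    etaStar p G H =
      ∑ D ∈ monicDivisors H, (mobius (H / D) : ℂ) * if D ∣ G then (absVal D : ℂ) else 0 := by
  rw [etaStar, Finset.filter_congr fun D _ => isUnitaryGcd_one_iff hH hs,
    sum_coprime_residues hH]
  rw [sum_monicDivisors_div hH fun D K =>
    (mobius K : ℂ) * if D ∣ G then (absVal D : ℂ) else 0]
  refine Finset.sum_congr rfl fun D hD => ?_
  obtain ⟨hDm, hDH⟩ := (mem_monicDivisors hH.ne_zero).1 hD
  have hK := monic_div hH hDm hDH
  rw [← sum_addCharE p hK G]
  congr 1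
  refine Finset.sum_congr rfl fun B _ => ?_
  rw [← addCharE_mul_left p hDm hK, mul_div_self hH.ne_zero hDH]

/-- The point is that the bound does not depend on `H`. -/
theorem norm_etaStar_le {G H : F[X]} (hG : G.Monic) (hH : H.Monic) (hs : Squarefree H) :
    ‖etaStar p G H‖ ≤ ∑ D ∈ monicDivisors G, absVal D := by
  classical
  rw [etaStar_eq_sum p hH hs]
  have h1 : ∀ D ∈ monicDivisors H,
      ‖(mobius (H / D) : ℂ) * if D ∣ G then (absVal D : ℂ) else 0‖ ≤
        if D ∣ G then absVal D else 0 := by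
    intro D _
    have h2 : ‖(mobius (H / D) : ℂ)‖ ≤ 1 := by
      have := abs_mobius_le_one (H / D)
      rw [← Complex.ofReal_intCast, Complex.norm_real]
      exact this
    rw [norm_mul]
    split_ifs
    · rw [Complex.norm_real, Real.norm_of_nonneg (absVal_nonneg D)]
      exact mul_le_of_le_one_left (absVal_nonneg D) h2
    · simp
  refine (norm_sum_le_of_le _ h1).trans ?_
  rw [← Finset.sum_filter]
  refine Finset.sum_le_sum_of_subset_of_nonneg ?_ fun D _ _ => absVal_nonneg D
  intro D hD
  rw [Finset.mem_filter, mem_monicDivisors hH.ne_zero] at hD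
  exact (mem_monicDivisors hG.ne_zero).2 ⟨hD.1.1, hD.2⟩

/-- Möbius inversion over the monic divisors of `N`. -/
theorem sum_sum_mobius_div {N : F[X]} (hN : N.Monic) (g : F[X] → ℂ) :
    ∑ H ∈ monicDivisors N, ∑ D ∈ monicDivisors H, (mobius (H / D) : ℂ) * g D = g N := by
  classical
  have hsub : ∀ H ∈ monicDivisors N, monicDivisors H = {D ∈ monicDivisors N | D ∣ H} := by
    intro H hH
    obtain ⟨hHm, hHN⟩ := (mem_monicDivisors hN.ne_zero).1 hH
    ext D
    rw [Finset.mem_filter, mem_monicDivisors hHm.ne_zero, mem_monicDivisors hN.ne_zero]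
    exact ⟨fun h => ⟨⟨h.1, h.2.trans hHN⟩, h.2⟩, fun h => ⟨h.1.1, h.2⟩⟩
  have hinner : ∀ D ∈ monicDivisors N,
      ∑ H ∈ monicDivisors N with D ∣ H, (mobius (H / D) : ℂ) * g D =
        if D = N then g N else 0 := by
    intro D hD
    obtain ⟨hDm, hDN⟩ := (mem_monicDivisors hN.ne_zero).1 hD
    have hK := monic_div hN hDm hDN
    have hDK := mul_div_self hN.ne_zero hDN
    -- The `H` with `D ∣ H ∣ N` are the products `D * E` with `E ∣ N / D`.
    have hre : ∑ H ∈ monicDivisors N with D ∣ H, (mobius (H / D) : ℂ) =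
        ∑ E ∈ monicDivisors (N / D), (mobius E : ℂ) := by
      refine Finset.sum_nbij' (fun H => H / D) (fun E => D * E) ?_ ?_ ?_ ?_ (fun _ _ => rfl)
      · intro H hH
        rw [Finset.mem_filter, mem_monicDivisors hN.ne_zero] at hH
        rw [mem_monicDivisors hK.ne_zero]
        refine ⟨monic_div hH.1.1 hDm hH.2, ?_⟩
        rw [← mul_dvd_mul_iff_left hDm.ne_zero, hDK, mul_div_self hH.1.1.ne_zero hH.2]
        exact hH.1.2
      · intro E hE
        rw [mem_monicDivisors hK.ne_zero] at hE
        rw [Finset.mem_filter, mem_monicDivisors hN.ne_zero]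
        refine ⟨⟨hDm.mul hE.1, ?_⟩, dvd_mul_right _ _⟩
        rw [← hDK]
        exact mul_dvd_mul_left D hE.2
      · intro H hH
        rw [Finset.mem_filter, mem_monicDivisors hN.ne_zero] at hH
        exact mul_div_self hH.1.1.ne_zero hH.2
      · intro E _
        exact mul_div_self_left hDm.ne_zero E
    rw [← Finset.sum_mul, hre, ← Int.cast_sum, sum_mobius hK]
    by_cases h : D = N
    · subst h
      simp [EuclideanDomain.div_self hDm.ne_zero]
    · have : N / D ≠ 1 := by
        intro h1
        rw [h1, mul_one] at hDK
        exact h hDK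
      simp [h, this]
  have hmem : N ∈ monicDivisors N := (mem_monicDivisors hN.ne_zero).2 ⟨hN, dvd_rfl⟩
  calc ∑ H ∈ monicDivisors N, ∑ D ∈ monicDivisors H, (mobius (H / D) : ℂ) * g D
      = ∑ H ∈ monicDivisors N, ∑ D ∈ monicDivisors N,
          if D ∣ H then (mobius (H / D) : ℂ) * g D else 0 := by
        refine Finset.sum_congr rfl fun H hH => ?_
        rw [hsub H hH, Finset.sum_filter]
    _ = ∑ D ∈ monicDivisors N, if D = N then g N else 0 := by
        rw [Finset.sum_comm]
        refine Finset.sum_congr rfl fun D hD => ?_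
        rw [← Finset.sum_filter, hinner D hD]
    _ = g N := by
        rw [Finset.sum_ite_eq', if_pos hmem]

open Classical in
theorem sum_etaStar {N : F[X]} (hN : N.Monic) (hs : Squarefree N) (G : F[X]) :
    ∑ H ∈ monicDivisors N, etaStar p G H = if N ∣ G then (absVal N : ℂ) else 0 := by
  rw [← sum_sum_mobius_div hN fun D => if D ∣ G then (absVal D : ℂ) else 0]
  refine Finset.sum_congr rfl fun H hH => ?_
  obtain ⟨hHm, hHN⟩ := (mem_monicDivisors hN.ne_zero).1 hH
  exact etaStar_eq_sum p hHm (hs.squarefree_of_dvd hHN) G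

end RamanujanSum

/-! ### Dirichlet series over monic polynomials -/

section DirichletSeries

variable {F : Type*} [Field F] [Fintype F]

theorem absVal_rpow_pos {G : F[X]} (hG : G ≠ 0) (w : ℝ) : 0 < absVal G ^ w :=
  Real.rpow_pos_of_pos (absVal_pos hG) w

/-- There are `q ^ n` monic polynomials of degree `n`, whence a geometric series of ratio `q ^ (1 -
w) < 1`. -/
theorem summable_zeta (F : Type*) [Field F] [Fintype F] {w : ℝ} (hw : 1 < w) :
    Summable fun f : MonicPoly F => 1 / absVal f.1 ^ w := by
  set q : ℝ := (Fintype.card F : ℝ) with hq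
  have hq1 : 1 < q := by
    rw [hq]
    exact_mod_cast Fintype.one_lt_card
  have hq0 : 0 < q := by linarith
  have hs : Summable fun x : (n : ℕ) × (Fin n → F) => 1 / (q ^ x.1) ^ w := by
    rw [summable_sigma_of_nonneg fun x => by positivity]
    refine ⟨fun n => Summable.of_finite, ?_⟩
    have hr : ∀ n : ℕ, ∑' _ : Fin n → F, 1 / (q ^ n) ^ w = (q ^ (1 - w)) ^ n := by
      intro n
      rw [tsum_const, Nat.card_eq_fintype_card, Fintype.card_fun, Fintype.card_fin, nsmul_eq_mul]
      push_cast
      rw [← hq, ← Real.rpow_natCast (q ^ (1 - w)), ← Real.rpow_natCast q, ← Real.rpow_mul hq0.le,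
        ← Real.rpow_mul hq0.le, one_div, ← Real.rpow_neg hq0.le, ← Real.rpow_add hq0]
      congr 1
      ring
    simp only [hr]
    exact summable_geometric_of_lt_one (by positivity)
      (Real.rpow_lt_one_of_one_lt_of_neg hq1 (by linarith))
  let j : MonicPoly F → (n : ℕ) × (Fin n → F) := fun f => ⟨f.1.natDegree, fun i => f.1.coeff i⟩
  have hj : Function.Injective j := by
    intro f g hfg
    -- A left inverse of `j`: a monic polynomial is recovered from its degree and lower
    -- coefficients.
    let r : ((n : ℕ) × (Fin n → F)) → F[X] := fun x => X ^ x.1 + ∑ i, C (x.2 i) * X ^ (i : ℕ)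
    have hr : ∀ f : MonicPoly F, r (j f) = f.1 := by
      intro f
      conv_rhs => rw [f.2.as_sum]
      simp only [r, j]
      rw [Fin.sum_univ_eq_sum_range (fun i => C (f.1.coeff i) * X ^ i)]
    exact Subtype.ext (by rw [← hr f, ← hr g, hfg])
  refine (hs.comp_injective hj).congr fun f => ?_
  simp only [Function.comp_apply, j]
  rw [absVal_eq_pow f.2.ne_zero]

/-- Dirichlet convolution of absolutely convergent series over monic polynomials. -/
theorem hasSum_convolution {a b : F[X] → ℝ} (ha : Summable fun N : MonicPoly F => ‖a N.1‖)
    (hb : Summable fun N : MonicPoly F => ‖b N.1‖) :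
    HasSum (fun N : MonicPoly F => ∑ D ∈ monicDivisors N.1, a D * b (N.1 / D))
      ((∑' N : MonicPoly F, a N.1) * ∑' N : MonicPoly F, b N.1) := by
  have h := ha.of_norm.hasSum.mul hb.of_norm.hasSum (summable_mul_of_summable_norm ha hb)
  let g : MonicPoly F × MonicPoly F → (N : MonicPoly F) × monicDivisors N.1 := fun x =>
    ⟨⟨x.1.1 * x.2.1, x.1.2.mul x.2.2⟩,
      ⟨x.1.1, (mem_monicDivisors (x.1.2.mul x.2.2).ne_zero).2 ⟨x.1.2, dvd_mul_right _ _⟩⟩⟩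
  have hg : Function.Bijective g := by
    constructor
    · intro x y hxy
      have h1 : x.1.1 * x.2.1 = y.1.1 * y.2.1 := congrArg (fun z => z.1.1) hxy
      have h2 : x.1.1 = y.1.1 := congrArg (fun z => (z.2 : F[X])) hxy
      rw [h2] at h1
      exact Prod.ext (Subtype.ext h2) (Subtype.ext (mul_left_cancel₀ y.1.2.ne_zero h1))
    · rintro ⟨⟨N, hN⟩, ⟨D, hD⟩⟩
      obtain ⟨hDm, K, rfl⟩ := (mem_monicDivisors hN.ne_zero).1 hD
      exact ⟨(⟨D, hDm⟩, ⟨K, hDm.of_mul_monic_left hN⟩), rfl⟩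
  let e := Equiv.ofBijective g hg
  have h' : HasSum (fun y : (N : MonicPoly F) × monicDivisors N.1 =>
      a y.2.1 * b (y.1.1 / y.2.1)) ((∑' N : MonicPoly F, a N.1) * ∑' N : MonicPoly F, b N.1) := by
    rw [← e.hasSum_iff]
    refine h.congr_fun ?_
    intro x
    change a x.1.1 * b (x.1.1 * x.2.1 / x.1.1) = a x.1.1 * b x.2.1
    rw [mul_div_self_left x.1.2.ne_zero]
  refine h'.sigma fun N => ?_
  have := hasSum_fintype (fun D : monicDivisors N.1 => a D.1 * b (N.1 / D.1))
  rwa [Finset.sum_coe_sort (monicDivisors N.1) (fun D => a D * b (N.1 / D))] at this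

theorem card_monicDivisors_mul_le {A B : F[X]} (hA : A.Monic) (hB : B.Monic) :
    (monicDivisors (A * B)).card ≤ (monicDivisors A).card * (monicDivisors B).card := by
  classical
  refine (Finset.card_le_card ?_).trans (Finset.card_image₂_le (fun x y => x * y) _ _)
  intro D hD
  obtain ⟨hDm, hDd⟩ := (mem_monicDivisors (hA.mul hB).ne_zero).1 hD
  obtain ⟨x, y, hx, hy, hxy⟩ := exists_dvd_and_dvd_of_dvd_mul hDd
  have hx0 : x ≠ 0 := ne_zero_of_dvd_ne_zero hA.ne_zero hx
  have hy0 : y ≠ 0 := ne_zero_of_dvd_ne_zero hB.ne_zero hy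
  rw [Finset.mem_image₂]
  refine ⟨normalize x, (mem_monicDivisors hA.ne_zero).2
    ⟨monic_normalize hx0, normalize_dvd_iff.2 hx⟩, normalize y, (mem_monicDivisors hB.ne_zero).2
    ⟨monic_normalize hy0, normalize_dvd_iff.2 hy⟩, ?_⟩
  rw [← normalize_mul, ← hxy, hDm.normalize_eq_self]

/-- Induction by convolving the series with itself: as `d(N) ≤ d(D) d(N / D)`, each of the `d(N)`
summands at `N` is at least `d(N) ^ k / |N| ^ w`. -/
theorem summable_card_monicDivisors_pow {w : ℝ} (hw : 1 < w) (k : ℕ) :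
    Summable fun N : MonicPoly F => ((monicDivisors N.1).card : ℝ) ^ k * (1 / absVal N.1 ^ w) := by
  induction k with
  | zero => simpa using summable_zeta F hw
  | succ k ih =>
    have hnn : ∀ N : F[X], 0 ≤ ((monicDivisors N).card : ℝ) ^ k * (1 / absVal N ^ w) := fun N => by
      have := Real.rpow_nonneg (absVal_nonneg N) w
      positivity
    have hn : Summable fun N : MonicPoly F =>
        ‖((monicDivisors N.1).card : ℝ) ^ k * (1 / absVal N.1 ^ w)‖ := ih.norm
    have hconv := (hasSum_convolution
      (a := fun N => ((monicDivisors N).card : ℝ) ^ k * (1 / absVal N ^ w))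
      (b := fun N => ((monicDivisors N).card : ℝ) ^ k * (1 / absVal N ^ w)) hn hn).summable
    refine Summable.of_nonneg_of_le (fun N => ?_) (fun N => ?_) hconv
    · have := Real.rpow_nonneg (absVal_nonneg N.1) w
      positivity
    · rw [pow_succ', mul_assoc, ← nsmul_eq_mul]
      refine Finset.card_nsmul_le_sum _ _ _ fun D hD => ?_
      obtain ⟨hDm, hDN⟩ := (mem_monicDivisors N.2.ne_zero).1 hD
      have hK := monic_div N.2 hDm hDN
      have hDK := mul_div_self N.2.ne_zero hDN
      have h1 : 1 / absVal N.1 ^ w = (1 / absVal D ^ w) * (1 / absVal (N.1 / D) ^ w) := by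
        conv_lhs => rw [← hDK]
        rw [absVal_mul, Real.mul_rpow (absVal_nonneg _) (absVal_nonneg _), one_div_mul_one_div]
      have h2 : ((monicDivisors N.1).card : ℝ) ^ k ≤
          ((monicDivisors D).card : ℝ) ^ k * ((monicDivisors (N.1 / D)).card : ℝ) ^ k := by
        rw [← mul_pow]
        have := card_monicDivisors_mul_le hDm hK
        rw [hDK] at this
        gcongr
        exact_mod_cast this
      have h3 := (absVal_rpow_pos hDm.ne_zero w).le
      have h4 := (absVal_rpow_pos hK.ne_zero w).le
      calc _ ≤ (((monicDivisors D).card : ℝ) ^ k * ((monicDivisors (N.1 / D)).card : ℝ) ^ k) *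
            ((1 / absVal D ^ w) * (1 / absVal (N.1 / D) ^ w)) := by
              rw [h1]
              gcongr
        _ = _ := by ring

/-- The coefficient `μ(N) / |N| ^ w` of the reciprocal of the zeta function. -/
noncomputable def mobiusTerm (w : ℝ) (N : F[X]) : ℝ := (mobius N : ℝ) / absVal N ^ w

theorem mobiusTerm_mul {w : ℝ} {A B : F[X]} (h : IsCoprime A B) :
    mobiusTerm w (A * B) = mobiusTerm w A * mobiusTerm w B := by
  rw [mobiusTerm, mobius_mul h, absVal_mul, Real.mul_rpow (absVal_nonneg _) (absVal_nonneg _),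
    mobiusTerm, mobiusTerm]
  push_cast
  rw [mul_div_mul_comm]

theorem mobiusTerm_eq_zero {w : ℝ} {N : F[X]} (h : ¬ Squarefree N) : mobiusTerm w N = 0 := by
  rw [mobiusTerm, mobius_eq_zero h]
  simp

theorem norm_mobiusTerm_le (w : ℝ) (N : F[X]) : ‖mobiusTerm w N‖ ≤ 1 / absVal N ^ w := by
  have h := Real.rpow_nonneg (absVal_nonneg N) w
  rw [mobiusTerm, norm_div, Real.norm_of_nonneg h]
  gcongr
  exact abs_mobius_le_one N

theorem summable_norm_mobiusTerm {w : ℝ} (hw : 1 < w) :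
    Summable fun N : MonicPoly F => ‖mobiusTerm w N.1‖ :=
  (summable_zeta F hw).of_nonneg_of_le (fun _ => norm_nonneg _) fun N => norm_mobiusTerm_le w N.1

theorem tsum_mobiusTerm_mul_zeta {w : ℝ} (hw : 1 < w) :
    (∑' N : MonicPoly F, mobiusTerm w N.1) * zetaA F w = 1 := by
  classical
  have h := hasSum_convolution (a := mobiusTerm w) (b := fun N : F[X] => 1 / absVal N ^ w)
    (summable_norm_mobiusTerm hw) (summable_zeta F hw).norm
  rw [zetaA, ← h.tsum_eq]
  have hN : ∀ N : MonicPoly F,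
      ∑ D ∈ monicDivisors N.1, mobiusTerm w D * (1 / absVal (N.1 / D) ^ w) =
        if N.1 = 1 then 1 else 0 := by
    intro N
    have h1 : ∀ D ∈ monicDivisors N.1, mobiusTerm w D * (1 / absVal (N.1 / D) ^ w) =
        (mobius D : ℝ) * (1 / absVal N.1 ^ w) := by
      intro D hD
      obtain ⟨hDm, hDN⟩ := (mem_monicDivisors N.2.ne_zero).1 hD
      have hDK := mul_div_self N.2.ne_zero hDN
      conv_rhs => rw [← hDK]
      rw [absVal_mul, Real.mul_rpow (absVal_nonneg _) (absVal_nonneg _), mobiusTerm,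
        ← one_div_mul_one_div]
      ring
    rw [Finset.sum_congr rfl h1, ← Finset.sum_mul, ← Int.cast_sum, sum_mobius N.2]
    split_ifs with h1
    · rw [h1, absVal_one]
      simp
    · simp
  rw [tsum_congr hN, tsum_eq_single ⟨1, monic_one⟩]
  · simp
  · intro N hN
    exact if_neg fun h => hN (Subtype.ext h)

theorem tsum_monicDivisors_ite {E : Type*} [AddCommMonoid E] [TopologicalSpace E]
    {Q : F[X]} (hQ : Q.Monic) (f : F[X] → E) :
    open Classical in
    ∑' N : MonicPoly F, (if N.1 ∣ Q then f N.1 else 0) = ∑ D ∈ monicDivisors Q, f D := by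
  classical
  rw [tsum_eq_sum (s := (monicDivisors Q).subtype Monic),
    Finset.sum_subtype_of_mem (fun D => if D ∣ Q then f D else 0)
      fun D hD => ((mem_monicDivisors hQ.ne_zero).1 hD).1]
  · exact Finset.sum_congr rfl fun D hD =>
      if_pos ((mem_monicDivisors hQ.ne_zero).1 hD).2
  · intro N hN
    refine if_neg fun h => hN ?_
    rw [Finset.mem_subtype]
    exact (mem_monicDivisors hQ.ne_zero).2 ⟨N.2, h⟩

open Classical in
/-- The Möbius series factors over the divisors of `Q` and the polynomials prime to `Q`. -/
theorem tsum_mobiusTerm_factor {w : ℝ} (hw : 1 < w) {Q : F[X]} (hQ : Q.Monic) :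
    (∑ D ∈ monicDivisors Q, mobiusTerm w D) *
      ∑' M : MonicPoly F, (if IsCoprime M.1 Q then mobiusTerm w M.1 else 0) =
        ∑' N : MonicPoly F, mobiusTerm w N.1 := by
  have hb : ∀ (P : F[X] → Prop),
      Summable fun N : MonicPoly F => ‖if P N.1 then mobiusTerm w N.1 else 0‖ := by
    intro P
    refine (summable_norm_mobiusTerm hw).of_nonneg_of_le (fun _ => norm_nonneg _) fun N => ?_
    split_ifs
    · exact le_rfl
    · simp
  have h := hasSum_convolution (a := fun D => if D ∣ Q then mobiusTerm w D else 0)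
    (b := fun M => if IsCoprime M Q then mobiusTerm w M else 0) (hb fun D => D ∣ Q) (hb fun M => IsCoprime M Q)
  rw [tsum_monicDivisors_ite hQ] at h
  rw [← h.tsum_eq]
  refine tsum_congr fun N => ?_
  have hterm : ∀ D ∈ monicDivisors N.1,
      (if D ∣ Q then mobiusTerm w D else 0) *
        (if IsCoprime (N.1 / D) Q then mobiusTerm w (N.1 / D) else 0) =
      if D ∣ Q ∧ IsCoprime (N.1 / D) Q then mobiusTerm w N.1 else 0 := by
    intro D hD
    obtain ⟨hDm, hDN⟩ := (mem_monicDivisors N.2.ne_zero).1 hD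
    by_cases h1 : D ∣ Q
    · by_cases h2 : IsCoprime (N.1 / D) Q
      · rw [if_pos h1, if_pos h2, if_pos ⟨h1, h2⟩,
          ← mobiusTerm_mul (h2.of_isCoprime_of_dvd_right h1).symm, mul_div_self N.2.ne_zero hDN]
      · simp [h2]
    · simp [h1]
  rw [Finset.sum_congr rfl hterm]
  by_cases hs : Squarefree N.1
  swap
  · simp [mobiusTerm_eq_zero hs]
  -- For squarefree `N`, the only divisor `D ∣ Q` with `N / D` prime to `Q` is the gcd of `N` and
  -- `Q`, called `E` below.
  have hg0 : EuclideanDomain.gcd N.1 Q ≠ 0 :=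
    fun h => hQ.ne_zero (EuclideanDomain.gcd_eq_zero_iff.1 h).2
  obtain ⟨E, hm, hEN, hEQ, hmax⟩ :
      ∃ E : F[X], E.Monic ∧ E ∣ N.1 ∧ E ∣ Q ∧ ∀ D, D ∣ N.1 → D ∣ Q → D ∣ E :=
    ⟨normalize (EuclideanDomain.gcd N.1 Q), monic_normalize hg0,
      normalize_dvd_iff.2 (EuclideanDomain.gcd_dvd_left _ _),
      normalize_dvd_iff.2 (EuclideanDomain.gcd_dvd_right _ _),
      fun D h1 h2 => dvd_normalize_iff.2 (EuclideanDomain.dvd_gcd h1 h2)⟩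
  have hcopE : ∀ D, D ∣ N.1 → IsCoprime D (N.1 / D) := fun D hD =>
    isCoprime_of_squarefree_mul (by rwa [mul_div_self N.2.ne_zero hD])
  have hcop : IsCoprime (N.1 / E) Q := by
    have hu : EuclideanDomain.gcd (N.1 / E) Q ∣ N.1 / E := EuclideanDomain.gcd_dvd_left _ _
    have h1 : EuclideanDomain.gcd (N.1 / E) Q ∣ E :=
      hmax _ (hu.trans (Dvd.intro_left _ (mul_div_self N.2.ne_zero hEN)))
        (EuclideanDomain.gcd_dvd_right _ _)
    rw [← EuclideanDomain.gcd_isUnit_iff]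
    exact (hcopE E hEN).isUnit_of_dvd' h1 hu
  rw [Finset.sum_eq_single E]
  · rw [if_pos ⟨hEQ, hcop⟩]
  · intro D hD hne
    obtain ⟨hDm, hDN⟩ := (mem_monicDivisors N.2.ne_zero).1 hD
    refine if_neg ?_
    rintro ⟨h1, h2⟩
    apply hne
    have hED : E ∣ D := by
      have h3 : E ∣ D * (N.1 / D) := by rwa [mul_div_self N.2.ne_zero hDN]
      exact (h2.of_isCoprime_of_dvd_right hEQ).symm.dvd_of_dvd_mul_right h3
    exact eq_of_monic_of_associated hDm hm (associated_of_dvd_dvd (hmax D hDN h1) hED)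
  · intro h
    exact absurd ((mem_monicDivisors N.2.ne_zero).2 ⟨hm, hEN⟩) h

theorem jordan_eq_mul_sum {Q : F[X]} (hQ : Q.Monic) (w : ℝ) :
    jordan w Q = absVal Q ^ w * ∑ D ∈ monicDivisors Q, mobiusTerm w D := by
  rw [jordan, ← sum_monicDivisors_div hQ fun D K => (mobius D : ℝ) * absVal K ^ w, Finset.mul_sum]
  refine Finset.sum_congr rfl fun D hD => ?_
  obtain ⟨hDm, hDQ⟩ := (mem_monicDivisors hQ.ne_zero).1 hD
  have hDK := mul_div_self hQ.ne_zero hDQ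
  have h0 := (absVal_rpow_pos hDm.ne_zero w).ne'
  conv_rhs => rw [← hDK]
  rw [absVal_mul, Real.mul_rpow (absVal_nonneg _) (absVal_nonneg _), mobiusTerm]
  field_simp

open Classical in
-- Put `N = Q * M`; the term vanishes unless `M` is prime to `Q`, and is multiplicative when it is.
theorem tsum_mobiusTerm_multiples {w : ℝ} {Q : F[X]} (hQ : Q.Monic) :
    ∑' N : MonicPoly F, (if Q ∣ N.1 then mobiusTerm w N.1 else 0) =
      mobiusTerm w Q * ∑' M : MonicPoly F, if IsCoprime M.1 Q then mobiusTerm w M.1 else 0 := by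
  let g : MonicPoly F → MonicPoly F := fun M => ⟨Q * M.1, hQ.mul M.2⟩
  have hg : Function.Injective g := fun x y h =>
    Subtype.ext (mul_left_cancel₀ hQ.ne_zero (congrArg Subtype.val h))
  rw [← tsum_mul_left, ← hg.tsum_eq]
  · refine tsum_congr fun M => ?_
    simp only [g, dvd_mul_right, if_true]
    split_ifs with h
    · exact mobiusTerm_mul h.symm
    · rw [mul_zero]
      exact mobiusTerm_eq_zero fun hs => h (isCoprime_of_squarefree_mul hs).symm
  · intro N hN
    have hQN : Q ∣ N.1 := by
      by_contra h
      exact hN (if_neg h)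
    obtain ⟨K, hK⟩ := hQN
    exact ⟨⟨K, hQ.of_mul_monic_left (hK ▸ N.2)⟩, Subtype.ext hK.symm⟩

open Classical in
-- The series over `M` prime to `Q` equals `1 / ζ(w)` divided by `∑_{D ∣ Q} μ(D) / |D| ^ w`, and
-- that divisor sum is `φ_w(Q) / |Q| ^ w`.
theorem mobius_div_jordan {w : ℝ} (hw : 1 < w) {Q : F[X]} (hQ : Q.Monic) :
    (mobius Q : ℝ) / jordan w Q =
      zetaA F w * ∑' N : MonicPoly F, if Q ∣ N.1 then mobiusTerm w N.1 else 0 := by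
  rw [tsum_mobiusTerm_multiples hQ]
  by_cases hs : Squarefree Q
  swap
  · rw [mobiusTerm_eq_zero hs, mobius_eq_zero hs]
    simp
  have h1 := tsum_mobiusTerm_mul_zeta (F := F) hw
  rw [← tsum_mobiusTerm_factor hw hQ] at h1
  have hQ0 := (absVal_rpow_pos hQ.ne_zero w).ne'
  -- It is a factor of a product equal to `1`; hence also `φ_w(Q) ≠ 0`.
  have hs0 : ∑ D ∈ monicDivisors Q, mobiusTerm w D ≠ 0 := by
    intro h0
    rw [h0] at h1
    simp at h1
  rw [jordan_eq_mul_sum hQ, mobiusTerm, div_eq_iff (mul_ne_zero hQ0 hs0)]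
  field_simp
  linear_combination (-(mobius Q : ℝ)) * h1

end DirichletSeries

/-! ### The double series and its two orders of summation -/

section Expansion

variable {F : Type*} [Field F] {k : ℕ}

theorem monic_monicGcd (hk : 1 ≤ k) (G : Fin k → MonicPoly F) :
    (monicGcd fun i => (G i).1).Monic := by
  classical
  have h0 : (monicGcd fun i => (G i).1) ≠ 0 := by
    intro h
    -- Here `k ≥ 1` matters: the gcd of an empty family is `0`.
    exact (G ⟨0, hk⟩).2.ne_zero (Finset.gcd_eq_zero_iff.1 h ⟨0, hk⟩ (Finset.mem_univ _))
  have h1 : normalize (monicGcd fun i => (G i).1) = monicGcd fun i => (G i).1 :=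
    Finset.normalize_gcd
  rw [← h1]
  exact monic_normalize h0

theorem monic_monicLcm (H : Fin k → MonicPoly F) : (monicLcm fun i => (H i).1).Monic := by
  classical
  have h0 : (monicLcm fun i => (H i).1) ≠ 0 := by
    intro h
    obtain ⟨i, -, hi⟩ := Finset.lcm_eq_zero_iff.1 h
    exact (H i).2.ne_zero hi
  have h1 : normalize (monicLcm fun i => (H i).1) = monicLcm fun i => (H i).1 :=
    Finset.normalize_lcm
  rw [← h1]
  exact monic_normalize h0

theorem dvd_monicGcd {G : Fin k → F[X]} {D : F[X]} : D ∣ monicGcd G ↔ ∀ i, D ∣ G i := by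
  simp [monicGcd, Finset.dvd_gcd_iff]

theorem monicLcm_dvd {H : Fin k → F[X]} {N : F[X]} : monicLcm H ∣ N ↔ ∀ i, H i ∣ N := by
  simp [monicLcm, Finset.lcm_dvd_iff]

variable [Fintype F]

open Classical in
/-- The monic divisors of `N`, as elements of the subtype of monic polynomials. -/
noncomputable def divisorsSubtype (N : F[X]) : Finset (MonicPoly F) :=
  (monicDivisors N).subtype Monic

theorem mem_divisorsSubtype {N : F[X]} (hN : N ≠ 0) {D : MonicPoly F} :
    D ∈ divisorsSubtype N ↔ D.1 ∣ N := by
  classical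
  rw [divisorsSubtype, Finset.mem_subtype, mem_monicDivisors hN]
  exact ⟨fun h => h.2, fun h => ⟨D.2, h⟩⟩

theorem sum_divisorsSubtype {M : Type*} [AddCommMonoid M] {N : F[X]} (hN : N ≠ 0)
    (f : F[X] → M) : ∑ D ∈ divisorsSubtype N, f D.1 = ∑ D ∈ monicDivisors N, f D := by
  classical
  exact Finset.sum_subtype_of_mem f fun _ hD => ((mem_monicDivisors hN).1 hD).1

theorem card_divisorsSubtype {N : F[X]} (hN : N ≠ 0) :
    (divisorsSubtype N).card = (monicDivisors N).card := by
  have := sum_divisorsSubtype hN fun _ => 1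
  simpa using this

theorem mem_piFinset_divisors {N : F[X]} (hN : N ≠ 0) {H : Fin k → MonicPoly F} :
    H ∈ Fintype.piFinset (fun _ : Fin k => divisorsSubtype N) ↔ ∀ i, (H i).1 ∣ N := by
  simp [Fintype.mem_piFinset, mem_divisorsSubtype hN]

theorem jordan_div_eq_sum {G : F[X]} (hG : G.Monic) (k : ℕ) (s : ℝ) :
    jordan s G / absVal G ^ s =
      ∑ D ∈ monicDivisors G, mobiusTerm (k + s) D * absVal D ^ k := by
  rw [jordan_eq_mul_sum hG, mul_div_cancel_left₀ _ (absVal_rpow_pos hG.ne_zero s).ne']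
  refine Finset.sum_congr rfl fun D hD => ?_
  have hD0 := absVal_pos ((mem_monicDivisors hG.ne_zero).1 hD).1.ne_zero
  rw [mobiusTerm, mobiusTerm, Real.rpow_add hD0, Real.rpow_natCast]
  field_simp

variable (p : ℕ) [Fact p.Prime] [Algebra (ZMod p) F]

open Classical in
/-- The terms of the double series over `N` and tuples of divisors of `N`. -/
noncomputable def doubleTerm (w : ℝ) (G : Fin k → MonicPoly F) (N : MonicPoly F)
    (H : Fin k → MonicPoly F) : ℂ :=
  if ∀ i, (H i).1 ∣ N.1 then (mobiusTerm w N.1 : ℂ) * ∏ i, etaStar p (G i).1 (H i).1 else 0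

open Classical in
theorem norm_doubleTerm_le (w : ℝ) (G : Fin k → MonicPoly F) (N : MonicPoly F)
    (H : Fin k → MonicPoly F) :
    ‖doubleTerm p w G N H‖ ≤ if ∀ i, (H i).1 ∣ N.1 then
      (1 / absVal N.1 ^ w) * ∏ i, ∑ D ∈ monicDivisors (G i).1, absVal D else 0 := by
  rw [doubleTerm]
  split_ifs with h
  -- The bound on `η*` needs squarefree `H i`, which follows from `H i ∣ N`; for other `N` the
  -- factor `μ(N)` vanishes.
  · by_cases hs : Squarefree N.1
    · rw [norm_mul, Complex.norm_real, norm_prod]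
      have h1 := norm_mobiusTerm_le w N.1
      have h2 : ∏ i, ‖etaStar p (G i).1 (H i).1‖ ≤
          ∏ i, ∑ D ∈ monicDivisors (G i).1, absVal D :=
        Finset.prod_le_prod (fun i _ => norm_nonneg _) fun i _ =>
          norm_etaStar_le p (G i).2 (H i).2 (hs.squarefree_of_dvd (h i))
      exact mul_le_mul h1 h2 (Finset.prod_nonneg fun i _ => norm_nonneg _)
        ((norm_nonneg _).trans h1)
    · rw [mobiusTerm_eq_zero hs]
      simp only [Complex.ofReal_zero, zero_mul, norm_zero]
      exact mul_nonneg (one_div_nonneg.2 (Real.rpow_nonneg (absVal_nonneg _) _))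
        (Finset.prod_nonneg fun i _ => Finset.sum_nonneg fun D _ => absVal_nonneg D)
  · simp

theorem summable_doubleTerm {w : ℝ} (hw : 1 < w) (G : Fin k → MonicPoly F) :
    Summable fun x : MonicPoly F × (Fin k → MonicPoly F) => doubleTerm p w G x.1 x.2 := by
  classical
  refine Summable.of_norm_bounded ?_ fun x => norm_doubleTerm_le p w G x.1 x.2
  set C : ℝ := ∏ i, ∑ D ∈ monicDivisors (G i).1, absVal D with hC
  have hC0 : 0 ≤ C :=
    Finset.prod_nonneg fun i _ => Finset.sum_nonneg fun D _ => absVal_nonneg D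
  have hnn : ∀ N : MonicPoly F, 0 ≤ 1 / absVal N.1 ^ w * C := fun N =>
    mul_nonneg (one_div_nonneg.2 (Real.rpow_nonneg (absVal_nonneg _) _)) hC0
  have hz : ∀ N : MonicPoly F, ∀ H ∉ Fintype.piFinset (fun _ : Fin k => divisorsSubtype N.1),
      (if ∀ i, (H i).1 ∣ N.1 then 1 / absVal N.1 ^ w * C else 0) = 0 := fun N H hH =>
    if_neg fun h => hH ((mem_piFinset_divisors N.2.ne_zero).2 h)
  rw [summable_prod_of_nonneg]
  · refine ⟨fun N => summable_of_ne_finset_zero (hz N), ?_⟩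
    refine ((summable_card_monicDivisors_pow hw k).mul_right C).congr fun N => ?_
    rw [tsum_eq_sum (hz N), Finset.sum_congr rfl fun H hH =>
      if_pos ((mem_piFinset_divisors N.2.ne_zero).1 hH), Finset.sum_const,
      Fintype.card_piFinset_const, card_divisorsSubtype N.2.ne_zero, nsmul_eq_mul, ← mul_assoc]
    push_cast
    rfl
  · intro x
    dsimp only
    split_ifs
    · exact hnn _
    · exact le_rfl

theorem expansionTerm_eq {w : ℝ} (hw : 1 < w) (G H : Fin k → MonicPoly F) :
    expansionTerm p w G H = (zetaA F w : ℂ) * ∑' N : MonicPoly F, doubleTerm p w G N H := by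
  classical
  have h := congrArg (fun x : ℝ => (x : ℂ)) (mobius_div_jordan hw (monic_monicLcm H))
  simp only [Complex.ofReal_div, Complex.ofReal_intCast, Complex.ofReal_mul,
    Complex.ofReal_tsum] at h
  rw [expansionTerm, mul_div_right_comm, h, mul_assoc, ← tsum_mul_right]
  congr 1
  refine tsum_congr fun N => ?_
  rw [doubleTerm]
  simp only [monicLcm_dvd]
  split_ifs <;> simp

/-- The sum over tuples of divisors of `N` factors into `k` sums, each evaluated by `sum_etaStar`.
-/
theorem tsum_doubleTerm (w : ℝ) (G : Fin k → MonicPoly F) (N : MonicPoly F) :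
    open Classical in
    ∑' H : Fin k → MonicPoly F, doubleTerm p w G N H =
      if N.1 ∣ monicGcd fun i => (G i).1 then
        (mobiusTerm w N.1 : ℂ) * (absVal N.1 : ℂ) ^ k else 0 := by
  classical
  have h0 : ∀ H ∉ Fintype.piFinset (fun _ : Fin k => divisorsSubtype N.1),
      doubleTerm p w G N H = 0 :=
    fun H hH => if_neg fun h => hH ((mem_piFinset_divisors N.2.ne_zero).2 h)
  rw [tsum_eq_sum h0]
  have h1 : ∀ H ∈ Fintype.piFinset (fun _ : Fin k => divisorsSubtype N.1),
      doubleTerm p w G N H = (mobiusTerm w N.1 : ℂ) * ∏ i, etaStar p (G i).1 (H i).1 :=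
    fun H hH => if_pos ((mem_piFinset_divisors N.2.ne_zero).1 hH)
  rw [Finset.sum_congr rfl h1, ← Finset.mul_sum,
    ← Finset.prod_univ_sum (fun _ : Fin k => divisorsSubtype N.1)
      fun i (D : MonicPoly F) => etaStar p (G i).1 D.1]
  by_cases hs : Squarefree N.1
  · have h2 : ∀ i, ∑ D ∈ divisorsSubtype N.1, etaStar p (G i).1 D.1 =
        if N.1 ∣ (G i).1 then (absVal N.1 : ℂ) else 0 := fun i => by
      rw [sum_divisorsSubtype N.2.ne_zero fun D => etaStar p (G i).1 D, sum_etaStar p N.2 hs]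
    simp only [h2, dvd_monicGcd]
    split_ifs with h
    · simp [h]
    · obtain ⟨i, hi⟩ := not_forall.1 h
      rw [Finset.prod_eq_zero (Finset.mem_univ i) (if_neg hi), mul_zero]
  · simp [mobiusTerm_eq_zero hs]

theorem summable_norm_expansionTerm {w : ℝ} (hw : 1 < w) (G : Fin k → MonicPoly F) :
    Summable fun H : Fin k → MonicPoly F => ‖expansionTerm p w G H‖ := by
  simp only [expansionTerm_eq p hw, norm_mul]
  exact (((summable_doubleTerm p hw G).prod_symm.prod).norm).mul_left _

theorem jordan_div_eq_tsum (hk : 1 ≤ k) (G : Fin k → MonicPoly F) {s : ℝ} (hs : 1 < (k : ℝ) + s) :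
    ((jordan s (monicGcd fun i => (G i).1) / absVal (monicGcd fun i => (G i).1) ^ s : ℝ) : ℂ) =
      1 / ((zetaA F ((k : ℝ) + s) : ℝ) : ℂ) *
        ∑' H : Fin k → MonicPoly F, expansionTerm p ((k : ℝ) + s) G H := by
  classical
  have hg := monic_monicGcd hk G
  have hz : (zetaA F ((k : ℝ) + s) : ℂ) ≠ 0 := by
    have := tsum_mobiusTerm_mul_zeta (F := F) hs
    exact_mod_cast right_ne_zero_of_mul_eq_one this
  simp only [expansionTerm_eq p hs]
  -- After `ζ` cancels, absolute convergence of the double series permits summing over `H` before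
  -- `N`.
  rw [tsum_mul_left, ← mul_assoc, one_div_mul_cancel hz, one_mul,
    Summable.tsum_comm (f := fun N H => doubleTerm p ((k : ℝ) + s) G N H)
      (summable_doubleTerm p hs G)]
  simp only [tsum_doubleTerm]
  rw [tsum_monicDivisors_ite hg fun D =>
    (mobiusTerm ((k : ℝ) + s) D : ℂ) * (absVal D : ℂ) ^ k, jordan_div_eq_sum hg k s]
  push_cast
  rfl

end Expansion

end PolyRamanujan

theorem mainTheorem10 (p : ℕ) [Fact p.Prime] (F : Type*) [Field F] [Fintype F]
    [Algebra (ZMod p) F] (k : ℕ) (hk : 1 ≤ k) (G : Fin k → PolyRamanujan.MonicPoly F) :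
    (∀ s : ℝ, 1 < (k : ℝ) + s →
      Summable (fun f : PolyRamanujan.MonicPoly F =>
        1 / PolyRamanujan.absVal f.1 ^ ((k : ℝ) + s)) ∧
      Summable (fun H : Fin k → PolyRamanujan.MonicPoly F =>
        ‖PolyRamanujan.expansionTerm p ((k : ℝ) + s) G H‖) ∧
      ((PolyRamanujan.jordan s (PolyRamanujan.monicGcd fun i => (G i).1) /
          PolyRamanujan.absVal (PolyRamanujan.monicGcd fun i => (G i).1) ^ s : ℝ) : ℂ) =
        1 / ((PolyRamanujan.zetaA F ((k : ℝ) + s) : ℝ) : ℂ) *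
          ∑' H : Fin k → PolyRamanujan.MonicPoly F,
            PolyRamanujan.expansionTerm p ((k : ℝ) + s) G H) ∧
    (Summable (fun H : Fin k → PolyRamanujan.MonicPoly F =>
        ‖PolyRamanujan.expansionTerm p ((k : ℝ) + 1) G H‖) ∧
      (((PolyRamanujan.eulerPhi (PolyRamanujan.monicGcd fun i => (G i).1) : ℝ) /
          PolyRamanujan.absVal (PolyRamanujan.monicGcd fun i => (G i).1) : ℝ) : ℂ) =
        1 / ((PolyRamanujan.zetaA F ((k : ℝ) + 1) : ℝ) : ℂ) *
          ∑' H : Fin k → PolyRamanujan.MonicPoly F,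
            PolyRamanujan.expansionTerm p ((k : ℝ) + 1) G H) := by
  refine ⟨fun s hs => ⟨PolyRamanujan.summable_zeta F hs,
    PolyRamanujan.summable_norm_expansionTerm p hs G,
    PolyRamanujan.jordan_div_eq_tsum p hk G hs⟩, ?_⟩
  have h1 : (1 : ℝ) < (k : ℝ) + 1 := by
    have : (1 : ℝ) ≤ k := by exact_mod_cast hk
    linarith
  refine ⟨PolyRamanujan.summable_norm_expansionTerm p h1 G, ?_⟩
  rw [← PolyRamanujan.jordan_div_eq_tsum p hk G h1,
    PolyRamanujan.eulerPhi_eq_jordan_one (PolyRamanujan.monic_monicGcd hk G), Real.rpow_one]
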